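/- Let $R$ be a division ring, let $q\ge 1$, and let $M$ be an infinite right module over the matrix ring $S=M_q(R)$, regarded as a first-order structure for the language $\langle +,-,0,\{\cdot_r: r\in S\}\rangle$ of right $S$-modules. A subset of $M^n$ ($n\ge 1$) is pp-definable if it is defined by a positive primitive formula (an existentially quantified finite conjunction of atomic formulas) with parameters from $M$; a bijection between two pp-definable sets is pp-definable if its graph is. A colour is an equivalence class $[[A]]$ of pp-definable subsets $A\subseteq M^n$, $n\ge 1$, under the relation of being in pp-definable bijection. Let $\overline{\mathcal X}^*(M_S)$ be the set of all colours other than $[[\emptyset]]$; it is a monoid under the multiplication induced by Cartesian product, $[[A]]\cdot[[B]]=[[A\times B]]$, with the colour of a point as unit. Then there are isomorphisms of monoids $$\overline{\mathcal X}^*(M_{M_q(R)})\;\cong\; q\mathbb N\;\cong\;\mathbb N,$$ where $\mathbb N=\{0,1,2,\dots\}$ and $q\mathbb N=\{qk: k\in\mathbb N\}$ are monoids under addition. -/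

import Mathlib

namespace PPColours

open FirstOrder FirstOrder.Language

universe u v w

/-- The function symbols `0`, `-`, `· r` (for `r ∈ S`) and `+` of the language of right
`S`-modules. -/
inductive ModuleFunctions (S : Type u) : ℕ → Type u
  | zero : ModuleFunctions S 0
  | neg : ModuleFunctions S 1
  | smul (r : S) : ModuleFunctions S 1
  | add : ModuleFunctions S 2

/-- The first-order language `⟨+, -, 0, {· r : r ∈ S}⟩` of right `S`-modules. -/
def moduleLanguage (S : Type u) : FirstOrder.Language.{u, 0} where
  Functions := ModuleFunctions S
  Relations := fun _ => Empty

/-- A right `S`-module (a module over the opposite ring) as a structure for the language of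
right `S`-modules; the symbol attached to `r` is interpreted as `x ↦ x r`. -/
instance moduleStructure (S : Type u) [Ring S] (M : Type v) [AddCommGroup M] [Module Sᵐᵒᵖ M] :
    (moduleLanguage S).Structure M where
  funMap := fun {_} f x =>
    match f, x with
    | ModuleFunctions.zero, _ => 0
    | ModuleFunctions.neg, x => -x 0
    | ModuleFunctions.smul r, x => MulOpposite.op r • x 0
    | ModuleFunctions.add, x => x 0 + x 1
  RelMap := fun r _ => Empty.elim r

section Formulas

variable {L : FirstOrder.Language.{u, v}}

/-- Finite non-empty conjunctions of atomic formulas. -/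
inductive IsConjAtomic {α : Type w} {n : ℕ} : L.BoundedFormula α n → Prop
  | of_isAtomic {φ : L.BoundedFormula α n} (h : φ.IsAtomic) : IsConjAtomic φ
  | inf {φ ψ : L.BoundedFormula α n} (hφ : IsConjAtomic φ) (hψ : IsConjAtomic ψ) :
      IsConjAtomic (φ ⊓ ψ)

/-- Positive primitive formulas: `∃ y₁ … y_k, ψ(x, y)` with `ψ` a conjunction of atomic
formulas. -/
def IsPP {α : Type w} (φ : L.Formula α) : Prop :=
  ∃ (k : ℕ) (ψ : L.Formula (α ⊕ Fin k)), IsConjAtomic ψ ∧ φ = ψ.iExs (Fin k)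

theorem IsConjAtomic.relabel {α β : Type*} (g : α → β) {φ : L.Formula α}
    (h : IsConjAtomic φ) : IsConjAtomic (φ.relabel g : L.Formula β) := by
  induction h with
  | of_isAtomic h => exact .of_isAtomic (h.relabel _)
  | inf _ _ h₁ h₂ => exact .inf h₁ h₂

end Formulas

section Definable

variable (S : Type u) [Ring S] {M : Type v} [AddCommGroup M] [Module Sᵐᵒᵖ M]

/-- A set of tuples is pp-definable (with parameters from `M`) if it is defined by a
pp-formula of the language of right `S`-modules expanded by constants for all elements of `M`. -/
def IsPPDefinable {α : Type w} (A : Set (α → M)) : Prop :=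
  ∃ φ : (moduleLanguage S)[[M]].Formula α, IsPP φ ∧ A = {v | φ.Realize v}

variable {S}

theorem IsPPDefinable.of_exists {α β : Type*} [Finite β]
    (ψ : (moduleLanguage S)[[M]].Formula (α ⊕ β)) (hψ : IsConjAtomic ψ) :
    IsPPDefinable S {v : α → M | ∃ y : β → M, ψ.Realize (Sum.elim v y)} := by
  obtain ⟨k, ⟨e⟩⟩ := Finite.exists_equiv_fin β
  refine ⟨_, ⟨k, ψ.relabel (Sum.map id e), hψ.relabel _, rfl⟩, ?_⟩
  ext v
  simp only [Set.mem_ofPred_eq, Formula.realize_iExs, Formula.realize_relabel]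
  constructor
  · rintro ⟨y, hy⟩
    refine ⟨y ∘ e.symm, ?_⟩
    convert hy using 1
    ext (i | i) <;> simp
  · rintro ⟨y, hy⟩
    refine ⟨y ∘ e, ?_⟩
    convert hy using 1
    ext (i | i) <;> simp

theorem IsPPDefinable.exists_iff {α : Type*} {A : Set (α → M)} (h : IsPPDefinable S A) :
    ∃ (k : ℕ) (ψ : (moduleLanguage S)[[M]].Formula (α ⊕ Fin k)), IsConjAtomic ψ ∧
      A = {v | ∃ y : Fin k → M, ψ.Realize (Sum.elim v y)} := by
  obtain ⟨_, ⟨k, ψ, hψ, rfl⟩, rfl⟩ := h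
  refine ⟨k, ψ, hψ, ?_⟩
  ext v
  simp [Formula.realize_iExs]

theorem IsPPDefinable.inter {α : Type*} {A B : Set (α → M)} (hA : IsPPDefinable S A)
    (hB : IsPPDefinable S B) : IsPPDefinable S {v | v ∈ A ∧ v ∈ B} := by
  obtain ⟨k, ψ, hψ, rfl⟩ := hA.exists_iff
  obtain ⟨l, χ, hχ, rfl⟩ := hB.exists_iff
  convert IsPPDefinable.of_exists (S := S) (M := M) (α := α) (β := Fin k ⊕ Fin l)
    (ψ.relabel (Sum.map id Sum.inl) ⊓ χ.relabel (Sum.map id Sum.inr))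
    (.inf (hψ.relabel _) (hχ.relabel _)) using 1
  ext v
  simp only [Set.mem_ofPred_eq, Formula.realize_inf, Formula.realize_relabel]
  constructor
  · rintro ⟨⟨y, hy⟩, ⟨z, hz⟩⟩
    refine ⟨Sum.elim y z, ?_, ?_⟩
    · convert hy using 1
      ext (i | i) <;> simp
    · convert hz using 1
      ext (i | i) <;> simp
  · rintro ⟨y, h₁, h₂⟩
    refine ⟨⟨y ∘ Sum.inl, ?_⟩, ⟨y ∘ Sum.inr, ?_⟩⟩
    · convert h₁ using 1
      ext (i | i) <;> simp
    · convert h₂ using 1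
      ext (i | i) <;> simp

theorem IsPPDefinable.comp {α β : Type*} {A : Set (α → M)} (hA : IsPPDefinable S A)
    (g : α → β) : IsPPDefinable S {w : β → M | w ∘ g ∈ A} := by
  obtain ⟨k, ψ, hψ, rfl⟩ := hA.exists_iff
  convert IsPPDefinable.of_exists (S := S) (M := M) (α := β) (β := Fin k)
    (ψ.relabel (Sum.map g id)) (hψ.relabel _) using 1
  ext v
  simp only [Set.mem_ofPred_eq, Formula.realize_relabel]
  refine exists_congr fun y => ?_
  have : Sum.elim (v ∘ g) y = Sum.elim v y ∘ Sum.map g id := by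
    ext (i | i) <;> simp
  rw [this]

theorem IsPPDefinable.proj {α β : Type*} [Finite β] {A : Set (α ⊕ β → M)}
    (hA : IsPPDefinable S A) :
    IsPPDefinable S {v : α → M | ∃ y : β → M, Sum.elim v y ∈ A} := by
  obtain ⟨k, ψ, hψ, rfl⟩ := hA.exists_iff
  convert IsPPDefinable.of_exists (S := S) (M := M) (α := α) (β := β ⊕ Fin k)
    (ψ.relabel (Equiv.sumAssoc α β (Fin k))) (hψ.relabel _) using 1
  ext v
  simp only [Set.mem_ofPred_eq, Formula.realize_relabel]
  constructor
  · rintro ⟨y, z, h⟩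
    refine ⟨Sum.elim y z, ?_⟩
    convert h using 1
    ext ((i | i) | i) <;> simp
  · rintro ⟨y, h⟩
    refine ⟨y ∘ Sum.inl, y ∘ Sum.inr, ?_⟩
    convert h using 1
    ext ((i | i) | i) <;> simp

theorem IsPPDefinable.of_equal {α : Type*} (s t : (moduleLanguage S)[[M]].Term α) :
    IsPPDefinable S {v : α → M | s.realize v = t.realize v} := by
  convert IsPPDefinable.of_exists (S := S) (M := M) (α := α) (β := Empty)
    ((s.equal t).relabel Sum.inl) (IsConjAtomic.relabel _
      (.of_isAtomic (BoundedFormula.IsAtomic.equal _ _))) using 1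
  ext v
  simp [Formula.realize_relabel, Formula.realize_equal]

theorem isPPDefinable_eq {α : Type*} (i j : α) : IsPPDefinable S {v : α → M | v i = v j} :=
  IsPPDefinable.of_equal (S := S) (M := M) (Term.var i) (Term.var j)

theorem isPPDefinable_const {α : Type*} (i : α) (c : M) :
    IsPPDefinable S {v : α → M | v i = c} := by
  convert IsPPDefinable.of_equal (S := S) (M := M) (Term.var i)
    (Constants.term ((moduleLanguage S).con c)) using 3
  rw [Term.realize_var, Term.realize_constants]
  rfl

theorem isPPDefinable_univ {α : Type*} : IsPPDefinable S (Set.univ : Set (α → M)) := by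
  convert IsPPDefinable.of_equal (S := S) (M := M) (α := α)
    (Constants.term ((moduleLanguage S).con (0 : M)))
    (Constants.term ((moduleLanguage S).con (0 : M))) using 1
  simp

theorem IsPPDefinable.forall {α ι : Type*} [Finite ι] {A : ι → Set (α → M)}
    (h : ∀ i, IsPPDefinable S (A i)) : IsPPDefinable S {v | ∀ i, v ∈ A i} := by
  classical
  have := Fintype.ofFinite ι
  suffices H : ∀ s : Finset ι, IsPPDefinable S {v | ∀ i ∈ s, v ∈ A i} by
    simpa using H Finset.univ
  intro s
  induction s using Finset.induction_on with
  | empty => simpa using isPPDefinable_univ (S := S) (M := M) (α := α)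
  | insert a s _ ih => simpa using (h a).inter ih

end Definable

section Colours

variable (S : Type u) [Ring S] (M : Type v) [AddCommGroup M] [Module Sᵐᵒᵖ M]

/-- The pp-definable subsets of the powers `M ^ n`, `n ≥ 1`. -/
structure PPSet where
  dim : ℕ
  dim_pos : 1 ≤ dim
  carrier : Set (Fin dim → M)
  isPPDefinable : IsPPDefinable S carrier

variable {S M}

/-- The graph of the restriction of `f` to `A`, as a set of `(α ⊕ β)`-tuples. -/
def graphOn {α β : Type*} (f : (α → M) → (β → M)) (A : Set (α → M)) : Set (α ⊕ β → M) :=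
  {v | v ∘ Sum.inl ∈ A ∧ v ∘ Sum.inr = f (v ∘ Sum.inl)}

/-- There is a pp-definable bijection from `A` onto `B`. -/
def PPSet.Rel (A B : PPSet S M) : Prop :=
  ∃ f : (Fin A.dim → M) → (Fin B.dim → M),
    Set.BijOn f A.carrier B.carrier ∧ IsPPDefinable S (graphOn f A.carrier)

theorem PPSet.rel_of_comp {A B : PPSet S M} (σ : Fin B.dim → Fin A.dim)
    (h : Set.BijOn (fun v => v ∘ σ) A.carrier B.carrier) : A.Rel B := by
  refine ⟨fun v => v ∘ σ, h, ?_⟩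
  convert (A.isPPDefinable.comp (Sum.inl : Fin A.dim → Fin A.dim ⊕ Fin B.dim)).inter
    (IsPPDefinable.forall fun i : Fin B.dim =>
      isPPDefinable_eq (S := S) (M := M) (Sum.inr i : Fin A.dim ⊕ Fin B.dim)
        (Sum.inl (σ i))) using 1
  ext v
  simp [graphOn, funext_iff]

theorem PPSet.Rel.refl (A : PPSet S M) : A.Rel A :=
  PPSet.rel_of_comp id (Set.bijOn_id _)

theorem PPSet.Rel.symm {A B : PPSet S M} (h : A.Rel B) : B.Rel A := by
  classical
  obtain ⟨f, hf, hd⟩ := h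
  have hinv := hf.invOn_invFunOn
  refine ⟨Function.invFunOn f A.carrier, hinv.symm.bijOn
    hf.surjOn.mapsTo_invFunOn hf.mapsTo, ?_⟩
  convert hd.comp (Sum.swap : Fin A.dim ⊕ Fin B.dim → Fin B.dim ⊕ Fin A.dim) using 1
  ext v
  have h₁ : (v ∘ Sum.swap) ∘ (Sum.inl : Fin A.dim → Fin A.dim ⊕ Fin B.dim) = v ∘ Sum.inr := by
    ext; simp
  have h₂ : (v ∘ Sum.swap) ∘ (Sum.inr : Fin B.dim → Fin A.dim ⊕ Fin B.dim) = v ∘ Sum.inl := by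
    ext; simp
  simp only [graphOn, Set.mem_ofPred_eq, h₁, h₂]
  constructor
  · rintro ⟨hv, he⟩
    rw [he]
    exact ⟨hf.surjOn.mapsTo_invFunOn hv, (hinv.2 hv).symm⟩
  · rintro ⟨hv, he⟩
    rw [he]
    exact ⟨hf.mapsTo hv, (hinv.1 hv).symm⟩

theorem PPSet.Rel.trans {A B C : PPSet S M} (h : A.Rel B) (h' : B.Rel C) : A.Rel C := by
  obtain ⟨f, hf, hd⟩ := h
  obtain ⟨g, hg, hd'⟩ := h'
  refine ⟨g ∘ f, hg.comp hf, ?_⟩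
  convert ((hd.comp (β := (Fin A.dim ⊕ Fin C.dim) ⊕ Fin B.dim)
      (Sum.elim (Sum.inl ∘ Sum.inl) Sum.inr)).inter
    (hd'.comp (β := (Fin A.dim ⊕ Fin C.dim) ⊕ Fin B.dim)
      (Sum.elim Sum.inr (Sum.inl ∘ Sum.inr)))).proj using 1
  ext v
  have e₁ (y : Fin B.dim → M) : (Sum.elim v y ∘ Sum.elim (Sum.inl ∘ Sum.inl) Sum.inr) ∘
      (Sum.inl : Fin A.dim → Fin A.dim ⊕ Fin B.dim) = v ∘ Sum.inl := rfl
  have e₂ (y : Fin B.dim → M) : (Sum.elim v y ∘ Sum.elim (Sum.inl ∘ Sum.inl) Sum.inr) ∘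
      (Sum.inr : Fin B.dim → Fin A.dim ⊕ Fin B.dim) = y := rfl
  have e₃ (y : Fin B.dim → M) : (Sum.elim v y ∘ Sum.elim Sum.inr (Sum.inl ∘ Sum.inr)) ∘
      (Sum.inl : Fin B.dim → Fin B.dim ⊕ Fin C.dim) = y := rfl
  have e₄ (y : Fin B.dim → M) : (Sum.elim v y ∘ Sum.elim Sum.inr (Sum.inl ∘ Sum.inr)) ∘
      (Sum.inr : Fin C.dim → Fin B.dim ⊕ Fin C.dim) = v ∘ Sum.inr := rfl
  simp only [graphOn, Set.mem_ofPred_eq, e₁, e₂, e₃, e₄]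
  constructor
  · rintro ⟨hv, he⟩
    exact ⟨_, ⟨hv, rfl⟩, hf.mapsTo hv, he⟩
  · rintro ⟨y, ⟨hv, rfl⟩, _, he⟩
    exact ⟨hv, he⟩

variable (S M)

/-- Pp-definable bijection as an equivalence relation. -/
instance PPSet.setoid : Setoid (PPSet S M) where
  r := PPSet.Rel
  iseqv := ⟨PPSet.Rel.refl, PPSet.Rel.symm, PPSet.Rel.trans⟩

/-- Colours: the pp-definable bijection classes of pp-definable sets. -/
def Colour : Type v := Quotient (PPSet.setoid S M)

variable {S M}

/-- The Cartesian product of two pp-definable sets, inside `M ^ (n + m)`. -/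
def PPSet.prod (A B : PPSet S M) : PPSet S M where
  dim := A.dim + B.dim
  dim_pos := le_add_right A.dim_pos
  carrier := {v | v ∘ Fin.castAdd B.dim ∈ A.carrier ∧ v ∘ Fin.natAdd A.dim ∈ B.carrier}
  isPPDefinable := (A.isPPDefinable.comp _).inter (B.isPPDefinable.comp _)

variable (S M) in
/-- The one-point set `{0}` inside `M ^ 1`. -/
def PPSet.point : PPSet S M where
  dim := 1
  dim_pos := le_rfl
  carrier := {v | v 0 = 0}
  isPPDefinable := isPPDefinable_const 0 0

theorem PPSet.append_mem_prod {A B : PPSet S M} {x : Fin A.dim → M} {y : Fin B.dim → M} :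
    Fin.append x y ∈ (A.prod B).carrier ↔ x ∈ A.carrier ∧ y ∈ B.carrier := by
  have h₁ : Fin.append x y ∘ Fin.castAdd B.dim = x := by ext i; simp
  have h₂ : Fin.append x y ∘ Fin.natAdd A.dim = y := by ext i; simp
  change Fin.append x y ∘ Fin.castAdd B.dim ∈ A.carrier ∧
    Fin.append x y ∘ Fin.natAdd A.dim ∈ B.carrier ↔ _
  rw [h₁, h₂]

theorem eq_append_iff {M : Type v} {n m : ℕ} {v : Fin (n + m) → M} {x : Fin n → M} {y : Fin m → M} :
    v = Fin.append x y ↔ v ∘ Fin.castAdd m = x ∧ v ∘ Fin.natAdd n = y := by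
  constructor
  · rintro rfl
    constructor <;> ext i <;> simp
  · rintro ⟨rfl, rfl⟩
    ext i
    refine Fin.addCases (fun i => ?_) (fun i => ?_) i <;> simp

theorem PPSet.Rel.prod {A A' B B' : PPSet S M} (hA : A.Rel A') (hB : B.Rel B') :
    (A.prod B).Rel (A'.prod B') := by
  obtain ⟨f, hf, hdf⟩ := hA
  obtain ⟨g, hg, hdg⟩ := hB
  refine ⟨fun v => Fin.append (f (v ∘ Fin.castAdd B.dim)) (g (v ∘ Fin.natAdd A.dim)),
    ⟨?_, ?_, ?_⟩, ?_⟩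
  · rintro v ⟨hv₁, hv₂⟩
    exact append_mem_prod.2 ⟨hf.mapsTo hv₁, hg.mapsTo hv₂⟩
  · rintro v ⟨hv₁, hv₂⟩ w ⟨hw₁, hw₂⟩ h
    have h' := eq_append_iff.1 h
    have h₁ := hf.injOn hv₁ hw₁ ((eq_append_iff.1 rfl).1.symm.trans h'.1)
    have h₂ := hg.injOn hv₂ hw₂ ((eq_append_iff.1 rfl).2.symm.trans h'.2)
    exact (eq_append_iff.2 ⟨h₁, h₂⟩).trans (eq_append_iff.2 ⟨rfl, rfl⟩).symm
  · rintro w ⟨hw₁, hw₂⟩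
    obtain ⟨x, hx, hx'⟩ := hf.surjOn hw₁
    obtain ⟨y, hy, hy'⟩ := hg.surjOn hw₂
    refine ⟨Fin.append x y, append_mem_prod.2 ⟨hx, hy⟩, ?_⟩
    refine (eq_append_iff.2 ⟨?_, ?_⟩).symm
    · exact hx'.symm.trans (congrArg f (eq_append_iff.1 rfl).1.symm)
    · exact hy'.symm.trans (congrArg g (eq_append_iff.1 rfl).2.symm)
  · have H := (hdf.comp (β := Fin (A.dim + B.dim) ⊕ Fin (A'.dim + B'.dim))
      (Sum.map (Fin.castAdd B.dim) (Fin.castAdd B'.dim))).inter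
      (hdg.comp (β := Fin (A.dim + B.dim) ⊕ Fin (A'.dim + B'.dim))
        (Sum.map (Fin.natAdd A.dim) (Fin.natAdd A'.dim)))
    refine Eq.mpr (congrArg (IsPPDefinable S) (Set.ext fun v => ?_)) H
    constructor
    · rintro ⟨⟨h₁, h₂⟩, h⟩
      have h' := eq_append_iff.1 h
      exact ⟨⟨h₁, h'.1⟩, ⟨h₂, h'.2⟩⟩
    · rintro ⟨⟨h₁, h₁'⟩, ⟨h₂, h₂'⟩⟩
      exact ⟨⟨h₁, h₂⟩, eq_append_iff.2 ⟨h₁', h₂'⟩⟩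

theorem PPSet.prod_rel_comm (A B : PPSet S M) : (A.prod B).Rel (B.prod A) := by
  let σ (n m : ℕ) : Fin (m + n) → Fin (n + m) := Fin.append (Fin.natAdd n) (Fin.castAdd m)
  have hσ₁ (n m : ℕ) (v : Fin (n + m) → M) :
      (v ∘ σ n m) ∘ Fin.castAdd n = v ∘ Fin.natAdd n := by ext i; simp [σ]
  have hσ₂ (n m : ℕ) (v : Fin (n + m) → M) :
      (v ∘ σ n m) ∘ Fin.natAdd m = v ∘ Fin.castAdd m := by ext i; simp [σ]
  have hσ (n m : ℕ) (v : Fin (n + m) → M) : (v ∘ σ n m) ∘ σ m n = v := by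
    refine (eq_append_iff.2 ⟨?_, ?_⟩).trans (eq_append_iff.2 ⟨rfl, rfl⟩).symm
    · rw [hσ₁, hσ₂]
    · rw [hσ₂, hσ₁]
  have hm (A B : PPSet S M) : Set.MapsTo (fun v => v ∘ σ A.dim B.dim) (A.prod B).carrier
      (B.prod A).carrier := by
    rintro v ⟨h₁, h₂⟩
    refine ⟨?_, ?_⟩
    · rw [hσ₁]; exact h₂
    · rw [hσ₂]; exact h₁
  refine PPSet.rel_of_comp (σ A.dim B.dim) (Set.InvOn.bijOn (f' := fun v => v ∘ σ B.dim A.dim)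
    ⟨fun v _ => hσ _ _ v, fun v _ => hσ _ _ v⟩ (hm A B) (hm B A))

theorem PPSet.prod_rel_assoc (A B C : PPSet S M) :
    ((A.prod B).prod C).Rel (A.prod (B.prod C)) := by
  have e := Nat.add_assoc A.dim B.dim C.dim
  refine PPSet.rel_of_comp (A := (A.prod B).prod C) (B := A.prod (B.prod C)) (Fin.cast e.symm)
    (Set.InvOn.bijOn (f' := fun v => v ∘ Fin.cast e)
      ⟨fun v _ => rfl, fun v _ => rfl⟩ ?_ ?_)
  · rintro v ⟨⟨h₁, h₂⟩, h₃⟩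
    refine ⟨h₁, h₂, ?_⟩
    convert h₃ using 1
    ext i
    exact congrArg v (Fin.ext (Nat.add_assoc _ _ _).symm)
  · rintro v ⟨h₁, h₂, h₃⟩
    refine ⟨⟨h₁, h₂⟩, ?_⟩
    convert h₃ using 1
    ext i
    exact congrArg v (Fin.ext (Nat.add_assoc _ _ _))

theorem PPSet.prod_point_rel (A : PPSet S M) : (A.prod (PPSet.point S M)).Rel A := by
  refine PPSet.rel_of_comp (A := A.prod (PPSet.point S M)) (Fin.castAdd 1)
    ⟨fun v hv => hv.1, ?_, ?_⟩
  · rintro v ⟨_, hv⟩ w ⟨_, hw⟩ h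
    have h0 : v ∘ Fin.natAdd A.dim = w ∘ Fin.natAdd A.dim := by
      funext i
      obtain rfl : i = (0 : Fin 1) := Subsingleton.elim (α := Fin 1) i 0
      exact Eq.trans hv (Eq.symm hw)
    exact (eq_append_iff.2 ⟨h, h0⟩).trans (eq_append_iff.2 ⟨rfl, rfl⟩).symm
  · intro x hx
    exact ⟨Fin.append x (fun _ => 0), PPSet.append_mem_prod.2 ⟨hx, rfl⟩, (eq_append_iff.1 rfl).1⟩

/-- The class `[[A]]` of a pp-definable set `A`. -/
def PPSet.colour (A : PPSet S M) : Colour S M := Quotient.mk _ A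

/-- The commutative monoid of all colours under the multiplication induced by the Cartesian
product; the unit is the colour of a point. -/
instance Colour.instCommMonoid : CommMonoid (Colour S M) where
  mul := Quotient.map₂ PPSet.prod fun _ _ h₁ _ _ h₂ => PPSet.Rel.prod h₁ h₂
  one := (PPSet.point S M).colour
  mul_assoc := by
    rintro ⟨A⟩ ⟨B⟩ ⟨C⟩
    exact Quotient.sound (PPSet.prod_rel_assoc A B C)
  mul_comm := by
    rintro ⟨A⟩ ⟨B⟩
    exact Quotient.sound (PPSet.prod_rel_comm A B)
  mul_one := by
    rintro ⟨A⟩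
    exact Quotient.sound (PPSet.prod_point_rel A)
  one_mul := by
    rintro ⟨A⟩
    exact Quotient.sound ((PPSet.prod_rel_comm _ A).trans (PPSet.prod_point_rel A))

theorem PPSet.colour_mul (A B : PPSet S M) : A.colour * B.colour = (A.prod B).colour := rfl

theorem PPSet.colour_one : (1 : Colour S M) = (PPSet.point S M).colour := rfl

theorem PPSet.colour_eq_iff {A B : PPSet S M} : A.colour = B.colour ↔ A.Rel B :=
  Quotient.eq

/-- The class of the empty set. -/
def Colour.IsTrivial (c : Colour S M) : Prop :=
  ∃ A : PPSet S M, A.carrier = ∅ ∧ c = A.colour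

theorem PPSet.isTrivial_colour_iff {A : PPSet S M} : A.colour.IsTrivial ↔ A.carrier = ∅ := by
  constructor
  · rintro ⟨B, hB, h⟩
    obtain ⟨f, hf, -⟩ := PPSet.colour_eq_iff.1 h
    refine Set.eq_empty_of_forall_notMem fun v hv => ?_
    have := hf.mapsTo hv
    rw [hB] at this
    exact this
  · exact fun h => ⟨A, h, rfl⟩

variable (S M)

/-- The monoid of non-trivial colours, i.e. of all colours except the class of the empty set. -/
def nontrivialColours : Submonoid (Colour S M) where
  carrier := {c | ¬ c.IsTrivial}
  one_mem' := by
    change ¬ (PPSet.point S M).colour.IsTrivial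
    rw [PPSet.isTrivial_colour_iff, ← ne_eq, ← Set.nonempty_iff_ne_empty]
    exact ⟨fun _ => 0, rfl⟩
  mul_mem' := by
    rintro ⟨A⟩ ⟨B⟩ hA hB
    change ¬ (A.prod B).colour.IsTrivial
    change ¬ A.colour.IsTrivial at hA
    change ¬ B.colour.IsTrivial at hB
    rw [PPSet.isTrivial_colour_iff, ← ne_eq, ← Set.nonempty_iff_ne_empty] at hA hB ⊢
    obtain ⟨x, hx⟩ := hA
    obtain ⟨y, hy⟩ := hB
    exact ⟨Fin.append x y, PPSet.append_mem_prod.2 ⟨hx, hy⟩⟩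

end Colours

end PPColours

/-!
Write `S` for the matrix ring `M_n(R)`, `e` for a diagonal matrix unit of `S` and `E` for the ring of
endomorphisms of the `S`-module `M`. The non-trivial colours are the powers of the colour of
`M e = {m | m e = m}`, and these powers are pairwise distinct.

Three facts carry the proof.

* A pp-definable set is closed under `(x, y, z) ↦ z + φ (x - y)` for `φ ∈ E`, since terms are affine
  maps (`IsPPDefinable.affine`). So a non-empty one is a coset of an `E`-submodule of `M ^ N`, and a
  pp-definable bijection, having a pp-definable graph, is affine over `E`
  (`PPSet.Rel.exists_injective`).
* The `E`-module `M e` is simple (`isSimpleModule_unitImage`), because `M` is semisimple over `S` and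
  `e S` is a simple `S`-module. Hence `(M e) ^ k` has length `k` over `E`, and a pp-definable
  bijection between `(M e) ^ k` and `(M e) ^ l` forces `k = l` (`pow_unitSet_colour_injective`).
* The maps `m ↦ m e_{i o}` embed `M` in a finite power of `M e`. An `E`-submodule of a finite power
  of a simple module is mapped isomorphically onto a smaller power by some of the coordinates
  (`exists_finset_bijective`). Applied to the coset of a non-empty pp-definable set, this gives a
  bijection onto some `(M e) ^ k` given by coordinates, hence by terms, and therefore pp-definable
  (`PPSet.exists_rel_unitPower`).

Working over `E` avoids any quantifier elimination for pp-formulas: no normal form of such a formula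
is needed, only the closure property above.
-/

namespace PPColours

open FirstOrder FirstOrder.Language

universe u v

/-! ### Affine structure of pp-definable sets -/

section Affine

variable {S : Type u} [Ring S] {M : Type v} [AddCommGroup M] [Module Sᵐᵒᵖ M]

/-- Every term is an affine map, so it commutes with the ternary operations
`(x, y, z) ↦ z + φ (x - y)`, for `φ` an endomorphism of `M`. -/
theorem realize_affine {α : Type*} (t : (moduleLanguage S)[[M]].Term α)
    (φ : Module.End Sᵐᵒᵖ M) (x y z : α → M) :
    t.realize (fun i => z i + φ (x i - y i)) =
      t.realize z + φ (t.realize x - t.realize y) := by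
  induction t with
  | var i => rfl
  | @func l f ts ih =>
    rcases f with f | c
    · cases f with
      | zero =>
        change (0 : M) = 0 + φ (0 - 0)
        simp
      | neg =>
        change -((ts 0).realize _) = -((ts 0).realize z) +
          φ (-((ts 0).realize x) - -((ts 0).realize y))
        rw [ih]
        simp only [map_sub, map_neg]
        abel
      | smul r =>
        change MulOpposite.op r • ((ts 0).realize _) = MulOpposite.op r • ((ts 0).realize z) +
          φ (MulOpposite.op r • ((ts 0).realize x) - MulOpposite.op r • ((ts 0).realize y))
        rw [ih, ← smul_sub, map_smul, smul_add]
      | add =>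
        change (ts 0).realize _ + (ts 1).realize _ =
          ((ts 0).realize z + (ts 1).realize z) +
          φ (((ts 0).realize x + (ts 1).realize x) - ((ts 0).realize y + (ts 1).realize y))
        rw [ih, ih]
        simp only [map_sub, map_add]
        abel
    · match l, c with
      | 0, c =>
        have h (c : M) : c = c + φ (c - c) := by simp
        exact h c

theorem IsConjAtomic.realize_affine {α : Type*} {ψ : (moduleLanguage S)[[M]].Formula α}
    (hψ : IsConjAtomic ψ) (φ : Module.End Sᵐᵒᵖ M) {x y z : α → M}
    (hx : ψ.Realize x) (hy : ψ.Realize y) (hz : ψ.Realize z) :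
    ψ.Realize (fun i => z i + φ (x i - y i)) := by
  induction hψ with
  | of_isAtomic h =>
    cases h with
    | equal t₁ t₂ =>
      have key (v : α → M) : Formula.Realize (t₁.bdEqual t₂) v ↔
          (t₁.relabel (Sum.elim id (fun i : Fin 0 => i.elim0))).realize v =
          (t₂.relabel (Sum.elim id (fun i : Fin 0 => i.elim0))).realize v := by
        have e : Sum.elim v (default : Fin 0 → M) =
            v ∘ Sum.elim id (fun i : Fin 0 => i.elim0) := by
          funext i
          rcases i with i | i
          · rfl
          · exact i.elim0
        rw [Formula.Realize, BoundedFormula.realize_bdEqual, e, Term.realize_relabel,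
          Term.realize_relabel]
      rw [key] at hx hy hz ⊢
      rw [PPColours.realize_affine, PPColours.realize_affine, hx, hy, hz]
    | rel r ts => rcases r with r | r <;> exact r.elim
  | inf _ _ ih₁ ih₂ =>
    rw [Formula.realize_inf] at hx hy hz ⊢
    exact ⟨ih₁ hx.1 hy.1 hz.1, ih₂ hx.2 hy.2 hz.2⟩

/-- A pp-definable set is an affine subspace over the endomorphism ring of `M`. -/
theorem IsPPDefinable.affine {α : Type*} {A : Set (α → M)} (hA : IsPPDefinable S A)
    (φ : Module.End Sᵐᵒᵖ M) {x y z : α → M} (hx : x ∈ A) (hy : y ∈ A) (hz : z ∈ A) :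
    z + φ • (x - y) ∈ A := by
  obtain ⟨k, ψ, hψ, rfl⟩ := hA.exists_iff
  obtain ⟨a, ha⟩ := hx
  obtain ⟨b, hb⟩ := hy
  obtain ⟨c, hc⟩ := hz
  refine ⟨fun i => c i + φ (a i - b i), ?_⟩
  convert hψ.realize_affine φ ha hb hc using 1
  ext (i | i) <;> rfl

/-- The translate to the origin of a pp-definable set, as a submodule over the endomorphism
ring of `M`. -/
def IsPPDefinable.direction {α : Type*} {A : Set (α → M)} (hA : IsPPDefinable S A)
    {a : α → M} (ha : a ∈ A) : Submodule (Module.End Sᵐᵒᵖ M) (α → M) where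
  carrier := {x | a + x ∈ A}
  zero_mem' := by simpa using ha
  add_mem' {x y} hx hy := by
    have := hA.affine 1 hx ha hy
    simpa [add_assoc, add_comm y x] using this
  smul_mem' φ x hx := by
    have := hA.affine φ hx ha ha
    simpa using this

theorem IsPPDefinable.mem_direction {α : Type*} {A : Set (α → M)} (hA : IsPPDefinable S A)
    {a x : α → M} (ha : a ∈ A) : x ∈ hA.direction ha ↔ a + x ∈ A := Iff.rfl

theorem isPPDefinable_smul_eq {α : Type*} (r : S) (i j : α) :
    IsPPDefinable S {v : α → M | MulOpposite.op r • v i = v j} :=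
  IsPPDefinable.of_equal (S := S) (M := M)
    (Term.func (Sum.inl (ModuleFunctions.smul r) : (moduleLanguage S)[[M]].Functions 1)
      ![Term.var i]) (Term.var j)

/-- If two submodules over the endomorphism ring of `M` underlie pp-definable sets in
pp-definable bijection, then the first one embeds linearly in the second one: the bijection is
affine because its graph is, and its linear part is the embedding. -/
theorem PPSet.Rel.exists_injective {A B : PPSet S M} (h : A.Rel B)
    {N : Submodule (Module.End Sᵐᵒᵖ M) (Fin A.dim → M)} (hN : (N : Set _) = A.carrier)
    {P : Submodule (Module.End Sᵐᵒᵖ M) (Fin B.dim → M)} (hP : (P : Set _) = B.carrier) :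
    ∃ g : N →ₗ[Module.End Sᵐᵒᵖ M] P, Function.Injective g := by
  obtain ⟨f, hf, hd⟩ := h
  rw [← hN] at hf hd
  rw [← hP] at hf
  have graph_iff (x : Fin A.dim → M) (y : Fin B.dim → M) :
      Sum.elim x y ∈ graphOn f (N : Set (Fin A.dim → M)) ↔ x ∈ N ∧ y = f x := Iff.rfl
  have key (φ : Module.End Sᵐᵒᵖ M) {x y z} (hx : x ∈ N) (hy : y ∈ N) (hz : z ∈ N) :
      f (z + φ • (x - y)) = f z + φ • (f x - f y) := by
    have := hd.affine φ ((graph_iff x _).2 ⟨hx, rfl⟩) ((graph_iff y _).2 ⟨hy, rfl⟩)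
      ((graph_iff z _).2 ⟨hz, rfl⟩)
    have e : Sum.elim z (f z) + φ • (Sum.elim x (f x) - Sum.elim y (f y)) =
        Sum.elim (z + φ • (x - y)) (f z + φ • (f x - f y)) := by
      ext (i | i) <;> rfl
    rw [e, graph_iff] at this
    exact this.2.symm
  refine ⟨{ toFun := fun x => ⟨f x - f 0, P.sub_mem (hf.mapsTo x.2) (hf.mapsTo N.zero_mem)⟩
            map_add' := fun x y => ?_
            map_smul' := fun φ x => ?_ }, fun x y hxy => ?_⟩
  · have := key 1 x.2 N.zero_mem y.2
    simp only [one_smul, sub_zero] at this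
    ext1
    simp only [Submodule.coe_add, add_comm (x : Fin A.dim → M), this]
    abel
  · have := key φ x.2 N.zero_mem N.zero_mem
    simp only [zero_add, sub_zero] at this
    ext1
    simp [this]
  · exact Subtype.ext (hf.injOn x.2 y.2 (sub_left_injective (congrArg Subtype.val hxy)))

end Affine

/-! ### Submodules of powers of a simple module -/

/-- A module that embeds in a finite power of a simple module by means of a family `p` of
coordinates is mapped isomorphically onto a power of it by some subfamily of `p`: any maximal
subfamily that is jointly surjective will do. -/
theorem exists_finset_bijective {E : Type*} [Ring E] {N V : Type*} [AddCommGroup N] [Module E N]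
    [AddCommGroup V] [Module E V] [IsSimpleModule E V] {ι : Type*} [Finite ι]
    (p : ι → N →ₗ[E] V) (hp : ∀ x, (∀ i, p i x = 0) → x = 0) :
    ∃ I : Finset ι, (∀ t : ι → V, ∃ x, ∀ i ∈ I, p i x = t i) ∧
      ∀ x, (∀ i ∈ I, p i x = 0) → x = 0 := by
  classical
  obtain ⟨I, hI, hmax⟩ := (Set.toFinite {I : Finset ι | ∀ t : ι → V, ∃ x, ∀ i ∈ I, p i x = t i})
    |>.exists_maximal ⟨∅, fun t => ⟨0, by simp⟩⟩
  refine ⟨I, hI, fun x hx => hp x fun j => ?_⟩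
  by_contra hj
  have hjI : j ∉ I := fun h => hj (hx j h)
  -- The values of the new coordinate on the common kernel of the old ones fill `V`.
  let K : Submodule E N := ⨅ i ∈ I, LinearMap.ker (p i)
  have hK : K.map (p j) = ⊤ := by
    refine (eq_bot_or_eq_top _).resolve_left fun h => hj ?_
    have : p j x ∈ K.map (p j) := Submodule.mem_map_of_mem (by simpa [K] using hx)
    simpa [h] using this
  refine hjI (hmax (y := insert j I) (fun t => ?_) (Finset.subset_insert j I)
    (Finset.mem_insert_self j I))
  obtain ⟨y, hy⟩ := hI t
  obtain ⟨z, hz, hz'⟩ : t j - p j y ∈ K.map (p j) := hK ▸ Submodule.mem_top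
  have hz₀ : ∀ i ∈ I, p i z = 0 := by simpa [K] using hz
  refine ⟨y + z, fun i hi => ?_⟩
  rcases Finset.mem_insert.1 hi with rfl | hi
  · rw [map_add, hz']; abel
  · rw [map_add, hy i hi, hz₀ i hi, add_zero]

/-! ### The simple module cut out by a matrix unit -/

section MatrixUnit

variable {R : Type*} [DivisionRing R] {n : Type*} [Fintype n] [DecidableEq n] (o : n)
  (M : Type v) [AddCommGroup M] [Module (Matrix n n R)ᵐᵒᵖ M]

variable (R) in
/-- The image `M e` of the diagonal matrix unit `e` at `o`, as a module over the endomorphism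
ring of `M`. -/
def unitImage : Submodule (Module.End (Matrix n n R)ᵐᵒᵖ M) M where
  carrier := {m | MulOpposite.op (Matrix.single o o (1 : R)) • m = m}
  zero_mem' := smul_zero _
  add_mem' {x y} hx hy := by
    change _ • (x + y) = x + y
    rw [smul_add, hx, hy]
  smul_mem' φ x hx := by
    change _ • φ x = φ x
    rw [← map_smul, hx]

variable {o M}

theorem mem_unitImage {m : M} :
    m ∈ unitImage R o M ↔ MulOpposite.op (Matrix.single o o (1 : R)) • m = m := Iff.rfl

theorem smul_single_mem_unitImage (i : n) (m : M) :
    MulOpposite.op (Matrix.single i o (1 : R)) • m ∈ unitImage R o M := by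
  rw [mem_unitImage, smul_smul, ← MulOpposite.op_mul, Matrix.single_mul_single_same, one_mul]

/-- The elements `m e_{i o}` are coordinates of `m`, because `∑ i, e_{i o} e_{o i} = 1`. -/
theorem eq_zero_of_smul_single {m : M}
    (h : ∀ i : n, MulOpposite.op (Matrix.single i o (1 : R)) • m = 0) : m = 0 := by
  have h₁ : (1 : Matrix n n R) = ∑ i, Matrix.single i o 1 * Matrix.single o i 1 := by
    simp only [Matrix.single_mul_single_same, mul_one]
    exact Matrix.sum_single_one.symm
  rw [← one_smul (Matrix n n R)ᵐᵒᵖ m, ← MulOpposite.op_one, h₁, Finset.op_sum,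
    Finset.sum_smul]
  refine Finset.sum_eq_zero fun i _ => ?_
  rw [MulOpposite.op_mul, mul_smul, h, smul_zero]

/-- The endomorphism ring of `M` is transitive on the non-zero elements of `M e`: such an
element `v` generates a copy of the simple module `e S`, and homomorphisms defined on a submodule
extend because `M` is semisimple. -/
theorem exists_end_apply_eq {v w : M} (hv : v ∈ unitImage R o M) (hw : w ∈ unitImage R o M)
    (hv0 : v ≠ 0) : ∃ φ : Module.End (Matrix n n R)ᵐᵒᵖ M, φ v = w := by
  have hker : LinearMap.ker (LinearMap.toSpanSingleton (Matrix n n R)ᵐᵒᵖ M v) ≤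
      LinearMap.ker (LinearMap.toSpanSingleton (Matrix n n R)ᵐᵒᵖ M w) := by
    intro A hA
    induction A using MulOpposite.rec' with | _ A
    rw [LinearMap.mem_ker, LinearMap.toSpanSingleton_apply] at hA ⊢
    -- Were some entry of row `o` of `A` non-zero, then `e` would be a right multiple of `e A`, and
    -- `v = v e` would vanish.
    have hrow : ∀ j, A o j = 0 := by
      by_contra! h
      obtain ⟨j, hj⟩ := h
      have e : Matrix.single o o 1 * A * Matrix.single j o (A o j)⁻¹ = Matrix.single o o 1 := by
        rw [Matrix.single_mul_mul_single]
        simp [hj]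
      apply hv0
      rw [← mem_unitImage.1 hv, ← e, MulOpposite.op_mul, MulOpposite.op_mul, mul_smul, mul_smul,
        mem_unitImage.1 hv, hA, smul_zero]
    have h0 : Matrix.single o o 1 * A = 0 := by
      ext i j
      by_cases hi : i = o
      · subst hi; simp [hrow]
      · simp [hi]
    rw [← mem_unitImage.1 hw, smul_smul, ← MulOpposite.op_mul, h0, MulOpposite.op_zero, zero_smul]
  obtain ⟨φ, hφ⟩ := IsSemisimpleModule.extension_property
    (Submodule.liftQ _ (LinearMap.toSpanSingleton (Matrix n n R)ᵐᵒᵖ M v) le_rfl)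
    (LinearMap.ker_eq_bot.1 (Submodule.ker_liftQ_eq_bot _ _ _ le_rfl))
    (Submodule.liftQ _ (LinearMap.toSpanSingleton (Matrix n n R)ᵐᵒᵖ M w) hker)
  refine ⟨φ, ?_⟩
  simpa using LinearMap.congr_fun hφ (Submodule.Quotient.mk 1)

instance isSimpleModule_unitImage [Nontrivial M] :
    IsSimpleModule (Module.End (Matrix n n R)ᵐᵒᵖ M) (unitImage R o M) := by
  rw [isSimpleModule_iff_isAtom]
  refine ⟨fun h => ?_, fun N hN => ?_⟩
  · obtain ⟨m, hm⟩ := exists_ne (0 : M)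
    refine hm (eq_zero_of_smul_single (R := R) (o := o) fun i => ?_)
    have := smul_single_mem_unitImage (R := R) (o := o) i m
    rwa [h, Submodule.mem_bot] at this
  · by_contra hN0
    obtain ⟨v, hvN, hv0⟩ := Submodule.exists_mem_ne_zero_of_ne_bot hN0
    refine hN.not_ge fun w hw => ?_
    obtain ⟨φ, rfl⟩ := exists_end_apply_eq (hN.le hvN) hw hv0
    exact N.smul_mem φ hvN

variable (o) in
/-- The coordinate `m ↦ m e_{i o}`, with values in `M e`. -/
def unitCoord (i : n) : M →ₗ[Module.End (Matrix n n R)ᵐᵒᵖ M] unitImage R o M where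
  toFun m := ⟨_, smul_single_mem_unitImage i m⟩
  map_add' x y := Subtype.ext (smul_add _ x y)
  map_smul' φ x := Subtype.ext (map_smul φ _ x).symm

end MatrixUnit

/-! ### Classification of the colours -/

section Classification

variable {R : Type*} [DivisionRing R] {n : Type*} [Fintype n] [DecidableEq n] (o : n)
  (M : Type v) [AddCommGroup M] [Module (Matrix n n R)ᵐᵒᵖ M]

variable (R) in
/-- The power `(M e) ^ k` of the image of the diagonal matrix unit `e` at `o`, for `k ≥ 0`. It is
placed inside `M ^ (k + 1)`, with first coordinate `0`, so that the ambient power is positive also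
when `k = 0`. -/
def unitPower (k : ℕ) : PPSet (Matrix n n R) M where
  dim := k + 1
  dim_pos := Nat.le_add_left 1 k
  carrier := {v | v 0 = 0 ∧ ∀ i : Fin k, v i.succ ∈ unitImage R o M}
  isPPDefinable := (isPPDefinable_const 0 0).inter
    (IsPPDefinable.forall fun i : Fin k => isPPDefinable_smul_eq _ i.succ i.succ)

variable (R) in
/-- The pp-definable set `M e ⊆ M`. -/
def unitSet : PPSet (Matrix n n R) M where
  dim := 1
  dim_pos := le_rfl
  carrier := {v | v 0 ∈ unitImage R o M}
  isPPDefinable := isPPDefinable_smul_eq _ 0 0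

variable (R) in
/-- The underlying submodule of `unitPower`. -/
def unitPowerSubmodule (k : ℕ) :
    Submodule (Module.End (Matrix n n R)ᵐᵒᵖ M) (Fin (k + 1) → M) where
  carrier := (unitPower R o M k).carrier
  zero_mem' := ⟨rfl, fun _ => zero_mem _⟩
  add_mem' {x y} hx hy := ⟨by simp [hx.1, hy.1], fun i => add_mem (hx.2 i) (hy.2 i)⟩
  smul_mem' φ x hx := ⟨by simp [hx.1], fun i => Submodule.smul_mem _ φ (hx.2 i)⟩

theorem length_unitPowerSubmodule [Nontrivial M] (k : ℕ) :
    Module.length (Module.End (Matrix n n R)ᵐᵒᵖ M) (unitPowerSubmodule R o M k) = k := by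
  let e : unitPowerSubmodule R o M k ≃ₗ[Module.End (Matrix n n R)ᵐᵒᵖ M]
      (Fin k → unitImage R o M) :=
    { toFun := fun x i => ⟨x.1 i.succ, x.2.2 i⟩
      invFun := fun y => ⟨Fin.cons 0 fun i => (y i).1, rfl, fun i => (y i).2⟩
      map_add' := fun x y => rfl
      map_smul' := fun φ x => rfl
      left_inv := fun x => by
        ext i
        refine Fin.cases ?_ (fun i => rfl) i
        exact x.2.1.symm
      right_inv := fun y => rfl }
  rw [e.length_eq, Module.length_pi_of_fintype]
  simp [Module.length_eq_one]

theorem unitPower_colour (k : ℕ) :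
    (unitPower R o M k).colour = (unitSet R o M).colour ^ k := by
  induction k with
  | zero =>
    rw [pow_zero, PPSet.colour_one, PPSet.colour_eq_iff]
    refine PPSet.rel_of_comp (A := unitPower R o M 0) (B := PPSet.point (Matrix n n R) M) id ?_
    have h : (unitPower R o M 0).carrier = (PPSet.point (Matrix n n R) M).carrier :=
      Set.ext fun v => ⟨fun hv => hv.1, fun hv => ⟨hv, fun i => i.elim0⟩⟩
    change Set.BijOn id _ _
    exact h ▸ Set.bijOn_id _
  | succ k ih =>
    rw [pow_succ, ← ih, PPSet.colour_mul, PPSet.colour_eq_iff]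
    refine PPSet.rel_of_comp (A := unitPower R o M (k + 1))
      (B := (unitPower R o M k).prod (unitSet R o M)) id ?_
    have h : (unitPower R o M (k + 1)).carrier =
        ((unitPower R o M k).prod (unitSet R o M)).carrier := by
      ext v
      constructor
      · rintro ⟨h₀, h⟩
        exact ⟨⟨h₀, fun i => h i.castSucc⟩, h (Fin.last k)⟩
      · rintro ⟨⟨h₀, h⟩, h'⟩
        exact ⟨h₀, fun i => Fin.lastCases h' h i⟩
    change Set.BijOn id _ _
    exact h ▸ Set.bijOn_id _

theorem pow_unitSet_colour_injective [Nontrivial M] :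
    Function.Injective fun k : ℕ => (unitSet R o M).colour ^ k := by
  have key {k l : ℕ} (h : (unitPower R o M k).Rel (unitPower R o M l)) : k ≤ l := by
    obtain ⟨g, hg⟩ : ∃ g : unitPowerSubmodule R o M k →ₗ[Module.End (Matrix n n R)ᵐᵒᵖ M]
        unitPowerSubmodule R o M l, Function.Injective g := h.exists_injective rfl rfl
    have := Module.length_le_of_injective g hg
    rw [length_unitPowerSubmodule, length_unitPowerSubmodule] at this
    exact_mod_cast this
  intro k l h
  change (unitSet R o M).colour ^ k = (unitSet R o M).colour ^ l at h
  rw [← unitPower_colour, ← unitPower_colour, PPSet.colour_eq_iff] at h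
  exact le_antisymm (key h) (key h.symm)

variable {M} in
/-- A non-empty pp-definable set is carried bijectively onto a power of `M e` by a suitable
family of the coordinates `v ↦ v j e_{i o}`. -/
theorem PPSet.exists_rel_unitPower [Nontrivial M] (A : PPSet (Matrix n n R) M)
    (hA : A.carrier.Nonempty) : ∃ k, A.Rel (unitPower R o M k) := by
  obtain ⟨a, ha⟩ := hA
  let N := A.isPPDefinable.direction ha
  let p (i : Fin A.dim × n) : N →ₗ[Module.End (Matrix n n R)ᵐᵒᵖ M] unitImage R o M :=
    unitCoord o i.2 ∘ₗ LinearMap.proj i.1 ∘ₗ N.subtype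
  obtain ⟨I, hsurj, hinj⟩ := exists_finset_bijective p fun x hx => by
    ext j
    exact eq_zero_of_smul_single fun i => congrArg Subtype.val (hx (j, i))
  let s (i : Fin I.card) : Fin A.dim × n := (I.equivFin.symm i).1
  have hs (i : Fin I.card) : s i ∈ I := (I.equivFin.symm i).2
  let f (v : Fin A.dim → M) : Fin (I.card + 1) → M :=
    Fin.cons 0 fun i => MulOpposite.op (Matrix.single (s i).2 o (1 : R)) • v (s i).1
  refine ⟨I.card, f, ⟨?_, ?_, ?_⟩, ?_⟩
  · exact fun v _ => ⟨rfl, fun i => smul_single_mem_unitImage _ _⟩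
  · intro x hx y hy hxy
    have hN {z} (hz : z ∈ A.carrier) : z - a ∈ N := by
      rw [IsPPDefinable.mem_direction, add_sub_cancel]
      exact hz
    have hd : x - y ∈ N := by simpa using N.sub_mem (hN hx) (hN hy)
    have := hinj ⟨x - y, hd⟩ fun i hi => by
      have h := congrFun hxy (I.equivFin ⟨i, hi⟩).succ
      simp only [f, s, Fin.cons_succ, Equiv.symm_apply_apply] at h
      ext1
      change _ • (x i.1 - y i.1) = 0
      rw [smul_sub, h, sub_self]
    exact sub_eq_zero.1 (congrArg Subtype.val this)
  · rintro w ⟨hw₀, hw⟩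
    obtain ⟨x, hx⟩ := hsurj fun i => if hi : i ∈ I then
      ⟨w (I.equivFin ⟨i, hi⟩).succ, hw _⟩ - unitCoord o i.2 (a i.1) else 0
    refine ⟨a + x, x.2, funext fun i => ?_⟩
    refine Fin.cases hw₀.symm (fun i => ?_) i
    have h := congrArg Subtype.val (hx (s i) (hs i))
    rw [dif_pos (hs i)] at h
    change _ • (x.1 (s i).1) = w (I.equivFin (I.equivFin.symm i)).succ - _ • a (s i).1 at h
    change _ • (a (s i).1 + x.1 (s i).1) = w i.succ
    rw [smul_add, h, Equiv.apply_symm_apply]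
    abel
  · have H := (A.isPPDefinable.comp (Sum.inl : Fin A.dim → Fin A.dim ⊕ Fin (I.card + 1))).inter
      ((isPPDefinable_const (Sum.inr 0) 0).inter (IsPPDefinable.forall fun i : Fin I.card =>
        isPPDefinable_smul_eq (S := Matrix n n R) (M := M) (Matrix.single (s i).2 o (1 : R))
          (Sum.inl (s i).1 : Fin A.dim ⊕ Fin (I.card + 1)) (Sum.inr i.succ)))
    refine Eq.mpr (congrArg (IsPPDefinable (Matrix n n R)) (Set.ext fun v => ?_)) H
    exact and_congr Iff.rfl
      ⟨fun h => ⟨congrFun h (0 : Fin (I.card + 1)), fun i => (congrFun h i.succ).symm⟩,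
        fun h => funext (Fin.cases h.1 fun i => (h.2 i).symm)⟩

/-- The non-trivial colours are the powers of the colour of `M e`. -/
theorem range_pow_unitSet_colour [Nontrivial M] :
    Set.range (fun k : ℕ => (unitSet R o M).colour ^ k) =
      nontrivialColours (Matrix n n R) M := by
  ext c
  constructor
  · rintro ⟨k, rfl⟩
    refine pow_mem (S := nontrivialColours (Matrix n n R) M) ?_ k
    change ¬ (unitSet R o M).colour.IsTrivial
    rw [PPSet.isTrivial_colour_iff, ← ne_eq, ← Set.nonempty_iff_ne_empty]
    exact ⟨0, zero_mem (unitImage R o M)⟩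
  · induction c using Quotient.inductionOn with | _ A
    intro hA
    change ¬ A.colour.IsTrivial at hA
    rw [PPSet.isTrivial_colour_iff, ← ne_eq, ← Set.nonempty_iff_ne_empty] at hA
    obtain ⟨k, hk⟩ := A.exists_rel_unitPower o hA
    exact ⟨k, (unitPower_colour o M k).symm.trans (PPSet.colour_eq_iff.2 hk.symm)⟩

theorem nonempty_nontrivialColours_mulEquiv [Nonempty n] [Nontrivial M] :
    Nonempty (Multiplicative ℕ ≃* nontrivialColours (Matrix n n R) M) := by
  obtain ⟨o⟩ := ‹Nonempty n›
  have hr := range_pow_unitSet_colour (R := R) o M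
  refine ⟨MulEquiv.ofBijective ((powersHom _ (unitSet R o M).colour).codRestrict
    (nontrivialColours (Matrix n n R) M) fun k => ?_) ⟨fun k l h => ?_, fun c => ?_⟩⟩
  · exact hr.le ⟨k.toAdd, rfl⟩
  · exact Multiplicative.toAdd.injective
      (pow_unitSet_colour_injective (R := R) o M (congrArg Subtype.val h))
  · obtain ⟨k, hk⟩ := hr.ge c.2
    exact ⟨Multiplicative.ofAdd k, Subtype.ext hk⟩

end Classification

theorem nonempty_nat_addEquiv_multiples {q : ℕ} (hq : q ≠ 0) :
    Nonempty (ℕ ≃+ AddSubmonoid.multiples q) :=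
  ⟨AddEquiv.ofBijective ((multiplesHom ℕ q).codRestrict (AddSubmonoid.multiples q)
    fun k => ⟨k, rfl⟩)
    ⟨fun _ _ h => Nat.eq_of_mul_eq_mul_right (Nat.pos_of_ne_zero hq) (congrArg Subtype.val h),
      fun ⟨_, k, hk⟩ => ⟨k, Subtype.ext hk⟩⟩⟩

end PPColours

theorem mainTheorem10 {R : Type*} [DivisionRing R] (q : ℕ) (hq : 1 ≤ q)
    (M : Type*) [AddCommGroup M] [Module (Matrix (Fin q) (Fin q) R)ᵐᵒᵖ M] [Infinite M] :
    Nonempty (PPColours.nontrivialColours (Matrix (Fin q) (Fin q) R) M ≃*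
      Multiplicative (AddSubmonoid.multiples q)) ∧
    Nonempty (AddSubmonoid.multiples q ≃+ ℕ) := by
  have : Nonempty (Fin q) := ⟨⟨0, hq⟩⟩
  obtain ⟨e⟩ := PPColours.nonempty_nontrivialColours_mulEquiv (R := R) (n := Fin q) M
  obtain ⟨g⟩ := PPColours.nonempty_nat_addEquiv_multiples (Nat.one_le_iff_ne_zero.1 hq)
  exact ⟨⟨e.symm.trans g.toMultiplicative⟩, ⟨g.symm⟩⟩
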